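/- Let $\mathrm{Diff}^{1+ac}_+([0,1])$ be the group of orientation-preserving $C^1$ diffeomorphisms $f$ of $[0,1]$ whose derivative $Df$ is absolutely continuous. For $f,g$ in this group put $$d^*_{1+ac}(f,g)=\|D(\log Df-\log Dg)\|_{L^1([0,1])},\qquad d_{1+ac}(f,g)=\|f-g\|_\infty+d^*_{1+ac}(f,g).$$ A $C^{1+ac}$ action of $\mathbb Z^d$ on $[0,1]$ is a homomorphism $\rho:\mathbb Z^d\to\mathrm{Diff}^{1+ac}_+([0,1])$. With $e_1,\dots,e_d$ the canonical generators, put $d^*_{1+ac}(\rho,\tilde\rho)=\max_i d^*_{1+ac}(\rho(e_i),\tilde\rho(e_i))$ and $d_{1+ac}(\rho,\tilde\rho)=\max_i d_{1+ac}(\rho(e_i),\tilde\rho(e_i))$ (both are $0$ if $d=0$). Let $\mathrm{id}$ denote the trivial action. Proposition. Let $\rho_0$ be a $C^{1+ac}$ action of $\mathbb Z^d$ on $[0,1]$ whose image is a cyclic group. Then there is a path $(\rho_t)_{t\in[0,1]}$ of $C^{1+ac}$ actions of $\mathbb Z^d$ on $[0,1]$, starting at $\rho_0$ and continuous for the distance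 $d_{1+ac}$, such that $\rho_1=\mathrm{id}$ and $$d^*_{1+ac}(\rho_t,\mathrm{id})\le 2\,d^*_{1+ac}(\rho_0,\mathrm{id})\qquad\text{for every } t\in[0,1].$$ Moreover, the path can be chosen so that, for each endpoint $p\in\{0,1\}$, if $D(\rho_0(v))(p)=1$ for all $v\in\mathbb Z^d$ (all the diffeomorphisms of the initial action are parabolic at $p$), then $D(\rho_t(v))(p)=1$ for all $t\in[0,1]$ and $v\in\mathbb Z^d$. -/

import Mathlib

open Set Filter MeasureTheory
open scoped Topology unitInterval

noncomputable section

/-- Orientation-preserving homeomorphisms of `[0,1]` are exactly its order automorphisms.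
They form a group under composition. -/
abbrev HomeoPlus : Type := I ≃o I

namespace HomeoPlus

/-- `f` as a real function on `[0,1]` (extended to `ℝ` by constants; only `[0,1]` matters). -/
def toReal (f : HomeoPlus) : ℝ → ℝ :=
  Set.IccExtend (zero_le_one (α := ℝ)) (fun x : I => ((f x : I) : ℝ))

/-- The derivative `Df` on `[0,1]` (one-sided at the endpoints). -/
def D (f : HomeoPlus) (x : ℝ) : ℝ := derivWithin f.toReal (Icc 0 1) x

/-- `log Df`. -/
def logD (f : HomeoPlus) (x : ℝ) : ℝ := Real.log (f.D x)

/-- `f` is a `C^{1+ac}` diffeomorphism of `[0,1]`: it is `C¹`, its derivative vanishes nowhere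
(so that the inverse is `C¹` as well), and the derivative is absolutely continuous. -/
structure IsC1ac (f : HomeoPlus) : Prop where
  contDiffOn : ContDiffOn ℝ 1 f.toReal (Icc 0 1)
  D_pos : ∀ x ∈ Icc (0 : ℝ) 1, 0 < f.D x
  ac : AbsolutelyContinuousOnInterval f.D 0 1

/-- `d*_{1+ac}(f,g) = ‖D(log Df - log Dg)‖_{L¹}`. -/
def distStar (f g : HomeoPlus) : ℝ :=
  ∫ x in (0 : ℝ)..1, |deriv (fun y => f.logD y - g.logD y) x|

/-- `d_{1+ac}(f,g) = ‖f - g‖_∞ + ‖D(log Df - log Dg)‖_{L¹}`. -/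
def dist1ac (f g : HomeoPlus) : ℝ :=
  (⨆ x : I, |((f x : I) : ℝ) - ((g x : I) : ℝ)|) + distStar f g

/-- `f` is parabolic at its fixed point `p`: the derivative there is `1`. -/
def IsParabolicAt (f : HomeoPlus) (p : I) : Prop := f p = p ∧ f.D (p : ℝ) = 1

end HomeoPlus

/-- Actions of `ℤ^d` on `[0,1]` by orientation-preserving homeomorphisms. -/
abbrev ZAction (d : ℕ) : Type := Multiplicative (Fin d → ℤ) →* HomeoPlus

namespace ZAction

variable {d : ℕ}

/-- The canonical generators of `ℤ^d`. -/
def gen (i : Fin d) : Multiplicative (Fin d → ℤ) := Multiplicative.ofAdd (Pi.single i 1)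

/-- The action is by `C^{1+ac}` diffeomorphisms. -/
def IsC1ac (ρ : ZAction d) : Prop := ∀ v, (ρ v).IsC1ac

/-- `d*_{1+ac}` for actions: the maximum over the canonical generators (`0` if `d = 0`). -/
def distStar (ρ η : ZAction d) : ℝ := ⨆ i : Fin d, (ρ (gen i)).distStar (η (gen i))

/-- `d_{1+ac}` for actions: the maximum over the canonical generators (`0` if `d = 0`). -/
def dist1ac (ρ η : ZAction d) : ℝ := ⨆ i : Fin d, (ρ (gen i)).dist1ac (η (gen i))

/-- A continuous path of `C^{1+ac}` actions, for the topology of the distance `d_{1+ac}`. -/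
structure IsC1acPath (γ : I → ZAction d) : Prop where
  isC1ac : ∀ t, (γ t).IsC1ac
  continuous : ∀ s, Tendsto (fun t => (γ t).dist1ac (γ s)) (𝓝 s) (𝓝 0)

end ZAction

end

/-!
The image of the action is generated by one diffeomorphism `f`, the generators acting as powers
`f ^ n i`, so a path of diffeomorphisms from `f` to the identity yields a path of actions by the
same exponents. What has to be controlled is the variation `V(g) = ‖D log Dg‖_{L¹}` of these powers
along the path. Let `N = max |n i|`.

By the cocycle relation `log D(fg) = log Df ∘ g + log Dg` and the invariance of the total variation
under reparametrization, `d*` is a right-invariant distance on the group of `C^{1+ac}`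
diffeomorphisms. It dominates the uniform distance, because two diffeomorphisms of `[0,1]` have
equal derivatives somewhere (`IsC1ac.abs_toReal_sub_le`). The group is a topological group for this
distance, which comes down to the continuity of precomposition in `L¹`
(`tendsto_derivNorm_comp_sub`); in particular conjugates and powers vary continuously.

The path has two stages.

* Conjugation: `f` is conjugated by diffeomorphisms `h_t`, where `log Dh_t` is, up to a constant,
  `t` times the average of `log D(f^i)` over `0 ≤ i < N`. The coboundary of this average telescopes:
  for `g` commuting with `f`, the function `log D(h_t g h_t⁻¹) ∘ h_t` is a convex combination of
  `log Dg` and of the average of the functions `log Dg ∘ f^i`. Hence `V` does not increase on powers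
  of `f` (`dist_avgConj_conj_le`), and at `t = 1` the conjugate of `f` itself has variation
  `V(f ^ N) / N` (`dist_avgConj_conj_self`).
* Interpolation: the conjugate `g` so obtained is joined to the identity by `(1 - t) g + t id`. The
  derivative of `y ↦ log ((1 - t) exp y + t)` lies in `[0,1]`, so `V` does not increase
  (`dist_interp_le`), and for `|n| ≤ N` subadditivity bounds the variation of the `n`-th power by
  `N * V(f ^ N) / N = V(f ^ N)`.

Both stages preserve a derivative equal to `1` at an endpoint. The bound is obtained with constant
`1` in place of `2`.
-/

/-! ### Absolutely continuous functions on `[0,1]` and the seminorm `‖Du‖_{L¹}` -/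

namespace AbsolutelyContinuousOnInterval

variable {X Y : Type*} [PseudoMetricSpace X] [PseudoMetricSpace Y]

theorem congr {u v : ℝ → X} {a b : ℝ} (hu : AbsolutelyContinuousOnInterval u a b)
    (h : EqOn u v (uIcc a b)) : AbsolutelyContinuousOnInterval v a b := by
  rw [absolutelyContinuousOnInterval_iff] at hu ⊢
  intro ε hε
  obtain ⟨δ, hδ, H⟩ := hu ε hε
  refine ⟨δ, hδ, fun E hE hE' => ?_⟩
  refine lt_of_eq_of_lt (Finset.sum_congr rfl fun i hi => ?_) (H E hE hE')
  rw [h (hE.1 i hi).1, h (hE.1 i hi).2]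

theorem lipschitzOnWith_comp {u : ℝ → X} {F : X → Y} {a b : ℝ} {K : NNReal}
    (hu : AbsolutelyContinuousOnInterval u a b) (hF : LipschitzOnWith K F (u '' uIcc a b)) :
    AbsolutelyContinuousOnInterval (F ∘ u) a b := by
  rw [absolutelyContinuousOnInterval_iff] at hu ⊢
  intro ε hε
  obtain ⟨δ, hδ, H⟩ := hu (ε / (K + 1)) (by positivity)
  refine ⟨δ, hδ, fun E hE hE' => ?_⟩
  have h1 : ∑ i ∈ Finset.range E.1, dist ((F ∘ u) (E.2 i).1) ((F ∘ u) (E.2 i).2) ≤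
      ∑ i ∈ Finset.range E.1, (K : ℝ) * dist (u (E.2 i).1) (u (E.2 i).2) :=
    Finset.sum_le_sum fun i hi => hF.dist_le_mul _ (mem_image_of_mem u (hE.1 i hi).1) _
      (mem_image_of_mem u (hE.1 i hi).2)
  rw [← Finset.mul_sum] at h1
  have h2 := H E hE hE'
  rw [lt_div_iff₀ (by positivity)] at h2
  have h3 : 0 ≤ ∑ i ∈ Finset.range E.1, dist (u (E.2 i).1) (u (E.2 i).2) :=
    Finset.sum_nonneg fun _ _ => dist_nonneg
  nlinarith

theorem contDiff_comp {u F : ℝ → ℝ} {a b : ℝ} (hu : AbsolutelyContinuousOnInterval u a b)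
    (hF : ContDiff ℝ 1 F) : AbsolutelyContinuousOnInterval (fun x => F (u x)) a b := by
  obtain ⟨C, hC⟩ := hu.exists_bound
  have hsub : u '' uIcc a b ⊆ Icc (-C) C := by
    rintro _ ⟨x, hx, rfl⟩
    exact abs_le.1 (hC x hx)
  obtain ⟨K, hK⟩ := hF.contDiffOn.exists_lipschitzOnWith (s := Icc (-C) C) (by decide)
    (convex_Icc _ _) isCompact_Icc
  exact hu.lipschitzOnWith_comp (hK.mono hsub)

theorem const {a b : ℝ} (c : X) : AbsolutelyContinuousOnInterval (fun _ => c) a b :=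
  (LipschitzWith.const c).lipschitzOnWith.absolutelyContinuousOnInterval

theorem sum {ι : Type*} {s : Finset ι} {u : ι → ℝ → ℝ} {a b : ℝ}
    (hu : ∀ i ∈ s, AbsolutelyContinuousOnInterval (u i) a b) :
    AbsolutelyContinuousOnInterval (fun x => ∑ i ∈ s, u i x) a b := by
  classical
  induction s using Finset.induction_on with
  | empty => simpa using const (0 : ℝ)
  | insert i s his ih =>
    simp only [Finset.sum_insert his]
    exact (hu i (by simp)).fun_add (ih fun j hj => hu j (by simp [hj]))

end AbsolutelyContinuousOnInterval

/-- `u` is absolutely continuous on `[0,1]`. -/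
abbrev IsAC (u : ℝ → ℝ) : Prop := AbsolutelyContinuousOnInterval u 0 1

/-- The seminorm `‖Du‖_{L¹([0,1])}`; for an absolutely continuous `u` this is its total
variation. -/
noncomputable def derivNorm (u : ℝ → ℝ) : ℝ := ∫ x in (0 : ℝ)..1, |deriv u x|

/-- `u` is, on `[0,1]`, a primitive of the integrable function `φ`. -/
structure HasDensity (u φ : ℝ → ℝ) : Prop where
  integrable : IntervalIntegrable φ volume 0 1
  eq_add_integral : ∀ x ∈ Icc (0 : ℝ) 1, u x = u 0 + ∫ y in (0 : ℝ)..x, φ y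

theorem ae_mem_Ioo_of_mem_uIoc :
    ∀ᵐ x : ℝ, x ∈ uIoc (0 : ℝ) 1 → x ∈ Ioo (0 : ℝ) 1 := by
  have h : ∀ᵐ x : ℝ, x ≠ 1 := by simp [ae_iff, measure_singleton]
  filter_upwards [h] with x hx hx'
  rw [uIoc_of_le zero_le_one] at hx'
  exact ⟨hx'.1, lt_of_le_of_ne hx'.2 hx⟩

theorem derivNorm_nonneg (u : ℝ → ℝ) : 0 ≤ derivNorm u :=
  intervalIntegral.integral_nonneg zero_le_one fun _ _ => abs_nonneg _

theorem derivNorm_congr {u v : ℝ → ℝ} (h : EqOn u v (Icc 0 1)) : derivNorm u = derivNorm v := by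
  refine intervalIntegral.integral_congr_ae ?_
  filter_upwards [ae_mem_Ioo_of_mem_uIoc] with x hx hx'
  have : u =ᶠ[𝓝 x] v := by
    filter_upwards [Ioo_mem_nhds (hx hx').1 (hx hx').2] with y hy
    exact h ⟨hy.1.le, hy.2.le⟩
  rw [this.deriv_eq]

theorem derivNorm_add_const (u : ℝ → ℝ) (c : ℝ) : derivNorm (fun x => u x + c) = derivNorm u := by
  simp [derivNorm]

theorem derivNorm_const_mul (u : ℝ → ℝ) (c : ℝ) :
    derivNorm (fun x => c * u x) = |c| * derivNorm u := by
  simp [derivNorm, abs_mul]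

theorem derivNorm_neg (u : ℝ → ℝ) : derivNorm (fun x => -u x) = derivNorm u := by
  simpa using derivNorm_const_mul u (-1)

theorem derivNorm_const (c : ℝ) : derivNorm (fun _ => c) = 0 := by
  simp [derivNorm]

namespace IsAC

variable {u v : ℝ → ℝ}

theorem congr (hu : IsAC u) (h : EqOn u v (Icc 0 1)) : IsAC v :=
  AbsolutelyContinuousOnInterval.congr hu (by rwa [uIcc_of_le zero_le_one])

theorem continuousOn (hu : IsAC u) : ContinuousOn u (Icc 0 1) := by
  simpa [uIcc_of_le] using AbsolutelyContinuousOnInterval.continuousOn hu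

theorem exists_bound (hu : IsAC u) : ∃ C, ∀ x ∈ Icc (0 : ℝ) 1, |u x| ≤ C := by
  simpa [uIcc_of_le] using AbsolutelyContinuousOnInterval.exists_bound hu

theorem ae_differentiableAt_of_mem (hu : IsAC u) :
    ∀ᵐ x : ℝ, x ∈ uIoc (0 : ℝ) 1 → DifferentiableAt ℝ u x := by
  filter_upwards [AbsolutelyContinuousOnInterval.ae_differentiableAt hu] with x hx hx'
  exact hx (uIoc_subset_uIcc hx')

theorem hasDensity (hu : IsAC u) : HasDensity u (deriv u) where
  integrable := hu.intervalIntegrable_deriv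
  eq_add_integral x hx := by
    have := (hu.mono (c := 0) (d := x) (by
      rw [uIcc_of_le hx.1, uIcc_of_le zero_le_one]
      exact Icc_subset_Icc_right hx.2)).integral_deriv_eq_sub
    linarith

theorem derivNorm_add_le (hu : IsAC u) (hv : IsAC v) :
    derivNorm (fun x => u x + v x) ≤ derivNorm u + derivNorm v := by
  have iu := hu.intervalIntegrable_deriv.abs
  have iv := hv.intervalIntegrable_deriv.abs
  have h1 : derivNorm (fun x => u x + v x) = ∫ x in (0 : ℝ)..1, |deriv u x + deriv v x| := by
    refine intervalIntegral.integral_congr_ae ?_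
    filter_upwards [hu.ae_differentiableAt_of_mem, hv.ae_differentiableAt_of_mem] with x h1 h2 h
    rw [deriv_fun_add (h1 h) (h2 h)]
  rw [h1, derivNorm, derivNorm, ← intervalIntegral.integral_add iu iv]
  refine intervalIntegral.integral_mono zero_le_one
    (hu.intervalIntegrable_deriv.add hv.intervalIntegrable_deriv).abs (iu.add iv) fun x => ?_
  exact abs_add_le _ _

theorem derivNorm_sum_le {ι : Type*} {s : Finset ι} {u : ι → ℝ → ℝ} (hu : ∀ i ∈ s, IsAC (u i)) :
    derivNorm (fun x => ∑ i ∈ s, u i x) ≤ ∑ i ∈ s, derivNorm (u i) := by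
  classical
  induction s using Finset.induction_on with
  | empty => simp [derivNorm]
  | insert i s his ih =>
    simp only [Finset.sum_insert his]
    have hs : ∀ j ∈ s, IsAC (u j) := fun j hj => hu j (by simp [hj])
    exact (derivNorm_add_le (hu i (by simp)) (AbsolutelyContinuousOnInterval.sum hs)).trans
      (by linarith [ih hs])

/-- Composition with a `C¹` function whose derivative is bounded by `C` on the values of `u`. -/
theorem derivNorm_comp_le (hu : IsAC u) {F : ℝ → ℝ} (hF : ContDiff ℝ 1 F) {C : ℝ}
    (hC : ∀ x ∈ Icc (0 : ℝ) 1, |deriv F (u x)| ≤ C) :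
    derivNorm (fun x => F (u x)) ≤ C * derivNorm u := by
  rw [derivNorm, derivNorm, ← intervalIntegral.integral_const_mul]
  refine intervalIntegral.integral_mono_ae_restrict zero_le_one
    (AbsolutelyContinuousOnInterval.contDiff_comp hu hF).intervalIntegrable_deriv.abs
    (hu.intervalIntegrable_deriv.abs.const_mul C) ?_
  refine (ae_restrict_iff' measurableSet_Icc).2 ?_
  filter_upwards [AbsolutelyContinuousOnInterval.ae_differentiableAt hu] with x hx hx'
  rw [show (fun x => F (u x)) = F ∘ u from rfl, deriv_comp x (hF.differentiable one_ne_zero _)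
    (hx (by rwa [uIcc_of_le zero_le_one])), abs_mul]
  exact mul_le_mul_of_nonneg_right (hC x hx') (abs_nonneg _)

/-- The oscillation is bounded by the seminorm. -/
theorem abs_sub_le_derivNorm (hu : IsAC u) {x y : ℝ} (hx : x ∈ Icc (0 : ℝ) 1)
    (hy : y ∈ Icc (0 : ℝ) 1) : |u x - u y| ≤ derivNorm u := by
  wlog hxy : y ≤ x generalizing x y
  · rw [abs_sub_comm]
    exact this hy hx (le_of_not_ge hxy)
  have hsub : uIcc y x ⊆ uIcc (0 : ℝ) 1 := by
    rw [uIcc_of_le hxy, uIcc_of_le zero_le_one]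
    exact Icc_subset_Icc hy.1 hx.2
  rw [← (hu.mono hsub).integral_deriv_eq_sub]
  refine (intervalIntegral.abs_integral_le_integral_abs hxy).trans ?_
  exact intervalIntegral.integral_mono_interval hy.1 hxy hx.2
    (ae_of_all _ fun _ => abs_nonneg _) hu.intervalIntegrable_deriv.abs

end IsAC

namespace HasDensity

variable {u v φ ψ : ℝ → ℝ}

theorem isAC (h : HasDensity u φ) : IsAC u := by
  have h1 : IsAC fun x => u 0 + ∫ y in (0 : ℝ)..x, φ y :=
    (AbsolutelyContinuousOnInterval.const (u 0)).fun_add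
      (h.integrable.absolutelyContinuousOnInterval_intervalIntegral (by simp))
  exact h1.congr fun x hx => (h.eq_add_integral x hx).symm

theorem derivNorm_eq (h : HasDensity u φ) : derivNorm u = ∫ x in (0 : ℝ)..1, |φ x| := by
  rw [derivNorm_congr (v := fun x => u 0 + ∫ y in (0 : ℝ)..x, φ y) h.eq_add_integral]
  refine intervalIntegral.integral_congr_ae ?_
  filter_upwards [h.integrable.ae_hasDerivAt_integral] with x hx hx'
  rw [((hx (uIoc_subset_uIcc hx') 0 (by simp)).const_add (u 0)).deriv]

theorem sub (h : HasDensity u φ) (h' : HasDensity v ψ) :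
    HasDensity (fun x => u x - v x) (fun x => φ x - ψ x) where
  integrable := h.integrable.sub h'.integrable
  eq_add_integral x hx := by
    have hsub : uIcc 0 x ⊆ uIcc (0 : ℝ) 1 := by
      rw [uIcc_of_le hx.1, uIcc_of_le zero_le_one]
      exact Icc_subset_Icc_right hx.2
    rw [intervalIntegral.integral_sub (h.integrable.mono_set hsub) (h'.integrable.mono_set hsub),
      h.eq_add_integral x hx, h'.eq_add_integral x hx]
    ring

/-- Change of variables: precomposition with an increasing differentiable bijection of `[0,1]`. -/
theorem comp {g g' : ℝ → ℝ} (h : HasDensity u φ) (hg : StrictMonoOn g (Icc 0 1))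
    (hg0 : g 0 = 0) (hg1 : g 1 = 1)
    (hg' : ∀ x ∈ Icc (0 : ℝ) 1, HasDerivWithinAt g (g' x) (Icc 0 1) x)
    (hpos : ∀ x ∈ Icc (0 : ℝ) 1, 0 ≤ g' x) :
    HasDensity (u ∘ g) (fun x => g' x * φ (g x)) := by
  have himage : ∀ x ∈ Icc (0 : ℝ) 1, g '' Icc 0 x = Icc 0 (g x) := by
    intro x hx
    have hsub : Icc 0 x ⊆ Icc (0 : ℝ) 1 := Icc_subset_Icc_right hx.2
    refine Subset.antisymm ?_ ?_
    · rintro _ ⟨y, hy, rfl⟩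
      refine ⟨?_, hg.monotoneOn (hsub hy) hx hy.2⟩
      rw [← hg0]
      exact hg.monotoneOn ⟨le_rfl, zero_le_one⟩ (hsub hy) hy.1
    · have hcont : ContinuousOn g (Icc 0 1) := fun y hy =>
        HasDerivWithinAt.continuousWithinAt (hg' y hy)
      have := intermediate_value_Icc hx.1 (ContinuousOn.mono hcont hsub)
      rwa [hg0] at this
  have hder : ∀ x ∈ Icc (0 : ℝ) 1, ∀ y ∈ Icc 0 x, HasDerivWithinAt g (g' y) (Icc 0 x) y :=
    fun x hx y hy => (hg' y ⟨hy.1, hy.2.trans hx.2⟩).mono (Icc_subset_Icc_right hx.2)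
  have hinj : ∀ x ∈ Icc (0 : ℝ) 1, InjOn g (Icc 0 x) := fun x hx =>
    hg.injOn.mono (Icc_subset_Icc_right hx.2)
  refine ⟨?_, fun x hx => ?_⟩
  · have h1 := integrableOn_image_iff_integrableOn_abs_deriv_smul measurableSet_Icc
      (hder 1 (by simp)) (hinj 1 (by simp)) φ
    rw [himage 1 (by simp), hg1] at h1
    rw [intervalIntegrable_iff_integrableOn_Icc_of_le zero_le_one]
    refine (h1.1 ((intervalIntegrable_iff_integrableOn_Icc_of_le zero_le_one).1
      h.integrable)).congr_fun (fun y hy => ?_) measurableSet_Icc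
    simp [abs_of_nonneg (hpos y hy)]
  · have h1 := integral_image_eq_integral_abs_deriv_smul measurableSet_Icc
      (hder x hx) (hinj x hx) φ
    rw [himage x hx] at h1
    have hgx : g x ∈ Icc (0 : ℝ) 1 := by
      have := himage 1 (by simp)
      rw [hg1] at this
      rw [← this]
      exact mem_image_of_mem g hx
    rw [Function.comp_apply, Function.comp_apply, hg0, h.eq_add_integral _ hgx,
      intervalIntegral.integral_of_le hgx.1, intervalIntegral.integral_of_le hx.1,
      ← integral_Icc_eq_integral_Ioc, ← integral_Icc_eq_integral_Ioc, h1]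
    congr 1
    refine setIntegral_congr_fun measurableSet_Icc fun y hy => ?_
    simp [abs_of_nonneg (hpos y ⟨hy.1, hy.2.trans hx.2⟩)]

end HasDensity

/-! ### Logarithmic derivatives of `C^{1+ac}` diffeomorphisms -/

namespace HomeoPlus

theorem toReal_coe (f : HomeoPlus) (x : I) : f.toReal x = f x := IccExtend_val _ _ _

theorem toReal_mem (f : HomeoPlus) (x : ℝ) : f.toReal x ∈ Icc (0 : ℝ) 1 := (f _).2

theorem toReal_mul (f g : HomeoPlus) (x : ℝ) : (f * g).toReal x = f.toReal (g.toReal x) := by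
  rw [show g.toReal x = ((g (projIcc 0 1 zero_le_one x) : I) : ℝ) from rfl, toReal_coe]
  rfl

theorem toReal_one {x : ℝ} (hx : x ∈ Icc (0 : ℝ) 1) : toReal 1 x = x :=
  toReal_coe 1 ⟨x, hx⟩

@[simp]
theorem toReal_zero (f : HomeoPlus) : f.toReal 0 = 0 := by
  have : f.toReal ((0 : I) : ℝ) = ((0 : I) : ℝ) := by
    rw [toReal_coe]; exact congrArg _ f.map_bot
  simpa using this

@[simp]
theorem toReal_at_one (f : HomeoPlus) : f.toReal 1 = 1 := by
  have : f.toReal ((1 : I) : ℝ) = ((1 : I) : ℝ) := by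
    rw [toReal_coe]; exact congrArg _ f.map_top
  simpa using this

theorem strictMonoOn_toReal (f : HomeoPlus) : StrictMonoOn f.toReal (Icc 0 1) := by
  intro x hx y hy hxy
  have h : (⟨x, hx⟩ : I) < ⟨y, hy⟩ := hxy
  have := f.strictMono h
  rwa [← Subtype.coe_lt_coe, ← toReal_coe, ← toReal_coe] at this

theorem continuous_toReal (f : HomeoPlus) : Continuous f.toReal :=
  (continuous_subtype_val.comp f.continuous).Icc_extend'

theorem ext_toReal {f g : HomeoPlus} (h : ∀ x ∈ Icc (0 : ℝ) 1, f.toReal x = g.toReal x) :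
    f = g := by
  ext x
  rw [← toReal_coe, ← toReal_coe, h x x.2]

theorem toReal_mul_inv (f : HomeoPlus) {x : ℝ} (hx : x ∈ Icc (0 : ℝ) 1) :
    f.toReal (f⁻¹.toReal x) = x := by
  rw [← toReal_mul, mul_inv_cancel, toReal_one hx]

theorem logD_eq_of_hasDerivWithinAt {f : HomeoPlus} {w x : ℝ} (hx : x ∈ Icc (0 : ℝ) 1)
    (h : HasDerivWithinAt f.toReal (Real.exp w) (Icc 0 1) x) : f.logD x = w := by
  rw [logD, D, h.derivWithin (uniqueDiffOn_Icc zero_lt_one x hx), Real.log_exp]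

/-- A homeomorphism whose derivative is the exponential of an absolutely continuous function is
a `C^{1+ac}` diffeomorphism. -/
theorem isC1ac_of_hasDerivWithinAt {f : HomeoPlus} {w : ℝ → ℝ} (hw : IsAC w)
    (h : ∀ x ∈ Icc (0 : ℝ) 1, HasDerivWithinAt f.toReal (Real.exp (w x)) (Icc 0 1) x) :
    f.IsC1ac := by
  have hD : EqOn f.D (fun x => Real.exp (w x)) (Icc 0 1) := fun x hx =>
    (h x hx).derivWithin (uniqueDiffOn_Icc zero_lt_one x hx)
  have hac : IsAC (fun x => Real.exp (w x)) :=
    AbsolutelyContinuousOnInterval.contDiff_comp hw Real.contDiff_exp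
  have hacD : IsAC f.D := IsAC.congr hac hD.symm
  have hdiff : DifferentiableOn ℝ f.toReal (Icc 0 1) := fun x hx => (h x hx).differentiableWithinAt
  have hcont : ContinuousOn (derivWithin f.toReal (Icc 0 1)) (Icc 0 1) := hacD.continuousOn
  refine ⟨?_, ?_, hacD⟩
  · exact (contDiffOn_one_iff_derivWithin (uniqueDiffOn_Icc zero_lt_one)).2 ⟨hdiff, hcont⟩
  · intro x hx
    exact (Real.exp_pos (w x)).trans_eq (hD hx).symm

namespace IsC1ac

variable {f g : HomeoPlus}

theorem hasDerivWithinAt (hf : f.IsC1ac) {x : ℝ} (hx : x ∈ Icc (0 : ℝ) 1) :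
    HasDerivWithinAt f.toReal (Real.exp (f.logD x)) (Icc 0 1) x := by
  rw [logD, Real.exp_log (hf.D_pos x hx)]
  exact (hf.contDiffOn.differentiableOn one_ne_zero x hx).hasDerivWithinAt

theorem hasDerivAt (hf : f.IsC1ac) {x : ℝ} (hx : x ∈ Ioo (0 : ℝ) 1) :
    HasDerivAt f.toReal (Real.exp (f.logD x)) x :=
  (hf.hasDerivWithinAt (Ioo_subset_Icc_self hx)).hasDerivAt (Icc_mem_nhds hx.1 hx.2)

theorem isAC_logD (hf : f.IsC1ac) : IsAC f.logD := by
  have hc : ContinuousOn f.D (Icc 0 1) := IsAC.continuousOn hf.ac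
  obtain ⟨a, ha, hmin⟩ := isCompact_Icc.exists_isMinOn (nonempty_Icc.2 zero_le_one) hc
  obtain ⟨b, hb, hmax⟩ := isCompact_Icc.exists_isMaxOn (nonempty_Icc.2 zero_le_one) hc
  have hsub : f.D '' uIcc 0 1 ⊆ Icc (f.D a) (f.D b) := by
    rintro _ ⟨x, hx, rfl⟩
    rw [uIcc_of_le zero_le_one] at hx
    exact ⟨hmin hx, hmax hx⟩
  have hlog : ContDiffOn ℝ 1 Real.log (Icc (f.D a) (f.D b)) :=
    Real.contDiffOn_log.mono fun x hx => ((hf.D_pos a ha).trans_le hx.1).ne'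
  obtain ⟨K, hK⟩ := hlog.exists_lipschitzOnWith (by decide) (convex_Icc _ _) isCompact_Icc
  exact hf.ac.lipschitzOnWith_comp (hK.mono hsub)

/-- Precomposing with a diffeomorphism transports densities. -/
theorem hasDensity_comp (hg : g.IsC1ac) {u φ : ℝ → ℝ} (h : HasDensity u φ) :
    HasDensity (fun x => u (g.toReal x)) (fun x => Real.exp (g.logD x) * φ (g.toReal x)) :=
  h.comp g.strictMonoOn_toReal g.toReal_zero g.toReal_at_one
    (fun _ hx => hg.hasDerivWithinAt hx) fun _ _ => (Real.exp_pos _).le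

theorem isAC_comp (hg : g.IsC1ac) {u : ℝ → ℝ} (hu : IsAC u) : IsAC (fun x => u (g.toReal x)) :=
  (hg.hasDensity_comp (IsAC.hasDensity hu)).isAC

theorem integral_exp_logD_mul (hg : g.IsC1ac) (φ : ℝ → ℝ) :
    ∫ x in (0 : ℝ)..1, Real.exp (g.logD x) * φ (g.toReal x) = ∫ x in (0 : ℝ)..1, φ x := by
  have himage : g.toReal '' Icc 0 1 = Icc 0 1 := by
    refine Subset.antisymm (by rintro _ ⟨x, -, rfl⟩; exact g.toReal_mem x) fun x hx => ?_
    exact ⟨_, g⁻¹.toReal_mem x, g.toReal_mul_inv hx⟩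
  have h1 := integral_image_eq_integral_abs_deriv_smul measurableSet_Icc
    (fun x hx => hg.hasDerivWithinAt hx) g.strictMonoOn_toReal.injOn φ
  rw [himage] at h1
  simpa [intervalIntegral.integral_of_le, ← integral_Icc_eq_integral_Ioc] using h1.symm

/-- The total variation is invariant under precomposition with a diffeomorphism. -/
theorem derivNorm_comp (hg : g.IsC1ac) {u : ℝ → ℝ} (hu : IsAC u) :
    derivNorm (fun x => u (g.toReal x)) = derivNorm u := by
  rw [(hg.hasDensity_comp (IsAC.hasDensity hu)).derivNorm_eq, derivNorm,
    ← hg.integral_exp_logD_mul (fun x => |deriv u x|)]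
  simp [abs_mul]

theorem hasDerivWithinAt_mul (hf : f.IsC1ac) (hg : g.IsC1ac) {x : ℝ} (hx : x ∈ Icc (0 : ℝ) 1) :
    HasDerivWithinAt (f * g).toReal (Real.exp (f.logD (g.toReal x) + g.logD x)) (Icc 0 1) x := by
  have h := (hf.hasDerivWithinAt (g.toReal_mem x)).comp x (hg.hasDerivWithinAt hx)
    fun y _ => g.toReal_mem y
  rw [Real.exp_add]
  exact h.congr_of_mem (fun y _ => toReal_mul f g y) hx

theorem logD_mul (hf : f.IsC1ac) (hg : g.IsC1ac) {x : ℝ} (hx : x ∈ Icc (0 : ℝ) 1) :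
    (f * g).logD x = f.logD (g.toReal x) + g.logD x :=
  logD_eq_of_hasDerivWithinAt hx (hf.hasDerivWithinAt_mul hg hx)

theorem mul (hf : f.IsC1ac) (hg : g.IsC1ac) : (f * g).IsC1ac :=
  isC1ac_of_hasDerivWithinAt ((hg.isAC_comp hf.isAC_logD).fun_add hg.isAC_logD)
    fun _ hx => hf.hasDerivWithinAt_mul hg hx

theorem hasDerivWithinAt_inv (hf : f.IsC1ac) {x : ℝ} (hx : x ∈ Icc (0 : ℝ) 1) :
    HasDerivWithinAt f⁻¹.toReal (Real.exp (-f.logD (f⁻¹.toReal x))) (Icc 0 1) x := by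
  have hpos := Real.exp_pos (f.logD (f⁻¹.toReal x))
  have hst : Tendsto f⁻¹.toReal (𝓝[Icc 0 1] x) (𝓝[Icc 0 1] (f⁻¹.toReal x)) :=
    f⁻¹.continuous_toReal.continuousWithinAt.tendsto_nhdsWithin fun y _ => f⁻¹.toReal_mem y
  have h := (hf.hasDerivWithinAt (f⁻¹.toReal_mem x)).hasFDerivWithinAt.of_comp_of_leftInverse
    hst (hasDerivWithinAt_id x (Icc 0 1)).hasFDerivWithinAt
    (eventually_nhdsWithin_of_forall fun y hy => f.toReal_mul_inv hy)
    (f'symm := .toSpanSingleton ℝ (Real.exp (f.logD (f⁻¹.toReal x)))⁻¹)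
    (fun y => by simp [hpos.ne']) hx
  have h' := h.hasDerivWithinAt
  rw [Real.exp_neg]
  simpa using h'

theorem inv (hf : f.IsC1ac) : f⁻¹.IsC1ac := by
  have h := (IsAC.hasDensity hf.isAC_logD).comp f⁻¹.strictMonoOn_toReal f⁻¹.toReal_zero
    f⁻¹.toReal_at_one (fun _ hx => hf.hasDerivWithinAt_inv hx) fun _ _ => (Real.exp_pos _).le
  exact isC1ac_of_hasDerivWithinAt h.isAC.fun_neg fun _ hx => hf.hasDerivWithinAt_inv hx

end IsC1ac

end HomeoPlus

/-! ### The group of `C^{1+ac}` diffeomorphisms as a topological group -/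

namespace HomeoPlus

theorem distStar_eq (f g : HomeoPlus) :
    f.distStar g = derivNorm (fun x => f.logD x - g.logD x) := rfl

theorem logD_one {x : ℝ} (hx : x ∈ Icc (0 : ℝ) 1) : logD 1 x = 0 := by
  refine logD_eq_of_hasDerivWithinAt hx ?_
  rw [Real.exp_zero]
  exact (hasDerivWithinAt_id x _).congr_of_mem (fun y hy => toReal_one hy) hx

theorem isC1ac_one : IsC1ac 1 :=
  isC1ac_of_hasDerivWithinAt (w := fun _ => 0) (AbsolutelyContinuousOnInterval.const 0)
    fun x hx => by
      rw [Real.exp_zero]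
      exact (hasDerivWithinAt_id x _).congr_of_mem (fun y hy => toReal_one hy) hx

theorem distStar_one (f : HomeoPlus) : f.distStar 1 = derivNorm f.logD :=
  derivNorm_congr fun x hx => by simp [logD_one hx]

theorem distStar_self (f : HomeoPlus) : f.distStar f = 0 := by
  simp [distStar_eq, derivNorm_const]

theorem distStar_comm (f g : HomeoPlus) : f.distStar g = g.distStar f := by
  rw [distStar_eq, distStar_eq, ← derivNorm_neg]
  simp

theorem distStar_nonneg (f g : HomeoPlus) : 0 ≤ f.distStar g := derivNorm_nonneg _

namespace IsC1ac

variable {f g h : HomeoPlus}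

theorem isAC_logD_sub (hf : f.IsC1ac) (hg : g.IsC1ac) : IsAC (fun x => f.logD x - g.logD x) :=
  hf.isAC_logD.fun_sub hg.isAC_logD

theorem distStar_triangle (hf : f.IsC1ac) (hg : g.IsC1ac) (hh : h.IsC1ac) :
    f.distStar h ≤ f.distStar g + g.distStar h := by
  have := IsAC.derivNorm_add_le (hf.isAC_logD_sub hg) (hg.isAC_logD_sub hh)
  simpa [distStar_eq] using this

/-- The pseudodistance `d*` is right-invariant. -/
theorem distStar_mul_right (hf : f.IsC1ac) (hg : g.IsC1ac) (hh : h.IsC1ac) :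
    (f * h).distStar (g * h) = f.distStar g := by
  rw [distStar_eq f, ← hh.derivNorm_comp (hf.isAC_logD_sub hg)]
  refine derivNorm_congr fun x hx => ?_
  simp only [hf.logD_mul hh hx, hg.logD_mul hh hx]
  ring

/-- Since `f - g` vanishes at both endpoints, `Df = Dg` somewhere; hence the oscillation of
`log Df - log Dg` bounds this function. -/
theorem abs_logD_sub_le (hf : f.IsC1ac) (hg : g.IsC1ac) {x : ℝ} (hx : x ∈ Icc (0 : ℝ) 1) :
    |f.logD x - g.logD x| ≤ f.distStar g := by
  obtain ⟨c, hc, hc'⟩ := exists_hasDerivAt_eq_zero (f := fun x => f.toReal x - g.toReal x)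
    zero_lt_one (f.continuous_toReal.sub g.continuous_toReal).continuousOn (by simp)
    fun y hy => (hf.hasDerivAt hy).sub (hg.hasDerivAt hy)
  have hlog : f.logD c = g.logD c := Real.exp_injective (sub_eq_zero.1 hc')
  have := IsAC.abs_sub_le_derivNorm (hf.isAC_logD_sub hg) hx (Ioo_subset_Icc_self hc)
  simpa [hlog, distStar_eq] using this

theorem toReal_sub_le (hf : f.IsC1ac) (hg : g.IsC1ac) {x : ℝ} (hx : x ∈ Icc (0 : ℝ) 1) :
    f.toReal x - g.toReal x ≤ Real.exp (f.distStar g) - 1 := by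
  set E := Real.exp (f.distStar g) with hE
  have hE1 : 1 ≤ E := Real.one_le_exp (distStar_nonneg f g)
  -- `f - E g` is nonincreasing, because `Df ≤ E Dg`
  have hanti : AntitoneOn (fun x => f.toReal x - E * g.toReal x) (Icc 0 1) := by
    refine antitoneOn_of_hasDerivWithinAt_nonpos (convex_Icc 0 1)
      (f' := fun x => Real.exp (f.logD x) - E * Real.exp (g.logD x))
      (f.continuous_toReal.sub (g.continuous_toReal.const_mul E)).continuousOn
      (fun y hy => ?_) fun y hy => ?_
    · rw [interior_Icc] at hy ⊢
      exact ((hf.hasDerivAt hy).sub ((hg.hasDerivAt hy).const_mul E)).hasDerivWithinAt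
    · have := (abs_le.1 (hf.abs_logD_sub_le hg (interior_subset hy))).2
      rw [hE, ← Real.exp_add, sub_nonpos]
      exact Real.exp_le_exp.2 (by linarith)
  have h1 := hanti ⟨le_rfl, zero_le_one⟩ hx hx.1
  simp only [toReal_zero, mul_zero, sub_zero] at h1
  have h2 := (g.toReal_mem x).2
  nlinarith

/-- The distance `d*` dominates the uniform distance. -/
theorem abs_toReal_sub_le (hf : f.IsC1ac) (hg : g.IsC1ac) {x : ℝ} (hx : x ∈ Icc (0 : ℝ) 1) :
    |f.toReal x - g.toReal x| ≤ Real.exp (f.distStar g) - 1 := by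
  refine abs_le.2 ⟨?_, hf.toReal_sub_le hg hx⟩
  have := hg.toReal_sub_le hf hx
  rw [distStar_comm] at this
  linarith

theorem eq_of_distStar_eq_zero (hf : f.IsC1ac) (hg : g.IsC1ac) (h : f.distStar g = 0) :
    f = g := by
  refine ext_toReal fun x hx => ?_
  have := hf.abs_toReal_sub_le hg hx
  rw [h, Real.exp_zero, sub_self] at this
  exact sub_eq_zero.1 (abs_nonpos_iff.1 this)

theorem dist1ac_le (hf : f.IsC1ac) (hg : g.IsC1ac) :
    f.dist1ac g ≤ (Real.exp (f.distStar g) - 1) + f.distStar g := by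
  refine add_le_add_left (ciSup_le fun x => ?_) _
  rw [← toReal_coe, ← toReal_coe]
  exact hf.abs_toReal_sub_le hg x.2

end IsC1ac

/-- The group of `C^{1+ac}` diffeomorphisms of `[0,1]`. -/
def c1ac : Subgroup HomeoPlus where
  carrier := {f | f.IsC1ac}
  mul_mem' hf hg := IsC1ac.mul hf hg
  one_mem' := isC1ac_one
  inv_mem' hf := IsC1ac.inv hf

namespace c1ac

theorem isC1ac (f : c1ac) : (f : HomeoPlus).IsC1ac := f.2

/-- The group of `C^{1+ac}` diffeomorphisms is metrized by `d*` alone: this distance dominates the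
uniform one, so it defines the same topology as `d_{1+ac}`. -/
noncomputable instance : MetricSpace c1ac where
  dist f g := (f : HomeoPlus).distStar g
  dist_self f := distStar_self _
  dist_comm f g := distStar_comm _ _
  dist_triangle f g h := (isC1ac f).distStar_triangle (isC1ac g) (isC1ac h)
  eq_of_dist_eq_zero {f g} h := Subtype.ext ((isC1ac f).eq_of_distStar_eq_zero (isC1ac g) h)

theorem dist_eq (f g : c1ac) : dist f g = (f : HomeoPlus).distStar g := rfl

theorem dist_one (f : c1ac) : dist f 1 = derivNorm (f : HomeoPlus).logD := distStar_one _

theorem dist_mul_right (f g h : c1ac) : dist (f * h) (g * h) = dist f g :=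
  (isC1ac f).distStar_mul_right (isC1ac g) (isC1ac h)

theorem dist_eq_dist_one (f g : c1ac) : dist f g = dist (f * g⁻¹) 1 := by
  rw [← dist_mul_right f g g⁻¹, mul_inv_cancel]

theorem dist_mul_one_le (f g : c1ac) : dist (f * g) 1 ≤ dist f 1 + dist g 1 := by
  have := dist_triangle (f * g) (1 * g) 1
  rwa [dist_mul_right, one_mul] at this

theorem dist_inv_one (f : c1ac) : dist f⁻¹ 1 = dist f 1 := by
  rw [← dist_mul_right f⁻¹ 1 f, inv_mul_cancel, one_mul, dist_comm]

theorem dist_pow_one_le (f : c1ac) (n : ℕ) : dist (f ^ n) 1 ≤ n * dist f 1 := by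
  induction n with
  | zero => simp
  | succ n ih =>
    rw [pow_succ]
    push_cast
    linarith [dist_mul_one_le (f ^ n) f]

theorem dist_zpow_one_eq (f : c1ac) (n : ℤ) : dist (f ^ n) 1 = dist (f ^ n.natAbs) 1 := by
  rcases Int.natAbs_eq n with h | h
  · conv_lhs => rw [h, zpow_natCast]
  · conv_lhs => rw [h, zpow_neg, zpow_natCast, dist_inv_one]

/-- Precomposition acts continuously on densities in `L¹`: for an absolutely continuous `u`, the
variation of `u ∘ h - u` tends to `0` as `h` tends to the identity. The density of `u` is
approximated in `L¹` by a continuous function, for which the convergence is uniform. -/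
theorem tendsto_derivNorm_comp_sub {u : ℝ → ℝ} (hu : IsAC u) :
    Tendsto (fun h : c1ac => derivNorm (fun x => u ((h : HomeoPlus).toReal x) - u x))
      (𝓝 1) (𝓝 0) := by
  have hφ := (intervalIntegrable_iff_integrableOn_Ioc_of_le zero_le_one).1
    hu.intervalIntegrable_deriv
  set φ := deriv u
  refine Metric.tendsto_nhds.2 fun ε hε => ?_
  obtain ⟨ψ, hψs, hψ, hψc, -⟩ := hφ.exists_hasCompactSupport_integral_sub_le (ε := ε / 4)
    (by positivity)
  rw [← intervalIntegral.integral_of_le zero_le_one] at hψ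
  obtain ⟨C, hC⟩ := hψs.exists_bound_of_continuous hψc
  have hC0 : 0 ≤ C := (norm_nonneg _).trans (hC 0)
  obtain ⟨η, hη, hη'⟩ := Metric.uniformContinuous_iff.1
    (hψs.uniformContinuous_of_continuous hψc) (ε / 8) (by positivity)
  have hdist : Tendsto (fun h : c1ac => dist h 1) (𝓝 1) (𝓝 0) :=
    tendsto_iff_dist_tendsto_zero.1 tendsto_id
  have hexp : Tendsto (fun h : c1ac => Real.exp (dist h 1) - 1) (𝓝 1) (𝓝 0) := by
    simpa using ((Real.continuous_exp.tendsto 0).comp hdist).sub_const 1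
  have hlim : Tendsto (fun h : c1ac => ε / 8 * (1 + (Real.exp (dist h 1) - 1)) +
      C * (Real.exp (dist h 1) - 1)) (𝓝 1) (𝓝 (ε / 8 * (1 + 0) + C * 0)) :=
    (((hexp.const_add 1).const_mul _)).add (hexp.const_mul C)
  filter_upwards [hexp.eventually (gt_mem_nhds hη),
    hlim.eventually (gt_mem_nhds (show _ < ε / 4 by linarith))] with h h1 h2
  have hh := (isC1ac h)
  set g := (h : HomeoPlus).toReal
  set g' := fun x => Real.exp ((h : HomeoPlus).logD x)
  have hgI : ∀ x ∈ Icc (0 : ℝ) 1, |g' x - 1| ≤ Real.exp (dist h 1) - 1 ∧ |g x - x| < η := by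
    intro x hx
    have hlog := hh.abs_logD_sub_le isC1ac_one hx
    rw [logD_one hx, sub_zero] at hlog
    obtain ⟨hl, hu⟩ := abs_le.1 hlog
    refine ⟨abs_le.2 ⟨?_, sub_le_sub_right (Real.exp_le_exp.2 hu) 1⟩, ?_⟩
    · have e1 := Real.add_one_le_exp ((h : HomeoPlus).logD x)
      have e2 := Real.add_one_le_exp (dist h 1)
      have e3 : -(dist h 1) ≤ (h : HomeoPlus).logD x := hl
      simp only [g']
      linarith
    · have := hh.abs_toReal_sub_le isC1ac_one hx
      rw [toReal_one hx] at this
      exact this.trans_lt h1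
  have hdens := hh.hasDensity_comp (IsAC.hasDensity hu)
  have iψ : IntervalIntegrable ψ volume 0 1 := hψc.intervalIntegrable 0 1
  have iA : IntervalIntegrable (fun x => |φ x - ψ x|) volume 0 1 :=
    (hu.intervalIntegrable_deriv.sub iψ).abs
  have iB : IntervalIntegrable (fun x => g' x * |φ (g x) - ψ (g x)|) volume 0 1 := by
    have hψ' : HasDensity (fun x => ∫ y in (0 : ℝ)..x, ψ y) ψ := ⟨iψ, by simp⟩
    refine (hdens.integrable.sub (hh.hasDensity_comp hψ').integrable).abs.congr fun x _ => ?_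
    rw [← mul_sub, abs_mul, abs_of_pos (Real.exp_pos _)]
  rw [dist_zero_right, Real.norm_of_nonneg (derivNorm_nonneg _),
    (hdens.sub (IsAC.hasDensity hu)).derivNorm_eq]
  have hle : ∫ x in (0 : ℝ)..1, |g' x * φ (g x) - φ x| ≤
      ∫ x in (0 : ℝ)..1, ((g' x * |φ (g x) - ψ (g x)| + ε / 4) + |φ x - ψ x|) := by
    refine intervalIntegral.integral_mono_on zero_le_one
      (hdens.sub (IsAC.hasDensity hu)).integrable.abs ((iB.add (by simp)).add iA) fun x hx => ?_
    obtain ⟨hg1, hgη⟩ := hgI x hx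
    have hg'0 : 0 < g' x := Real.exp_pos _
    have hψx : |ψ (g x) - ψ x| < ε / 8 := hη' hgη
    have e1 : |g' x * ψ (g x) - ψ x| ≤ ε / 4 := by
      calc |g' x * ψ (g x) - ψ x| = |g' x * (ψ (g x) - ψ x) + (g' x - 1) * ψ x| := by ring_nf
        _ ≤ g' x * |ψ (g x) - ψ x| + |g' x - 1| * |ψ x| := by
          refine (abs_add_le _ _).trans_eq ?_
          rw [abs_mul, abs_mul, abs_of_pos hg'0]
        _ ≤ (1 + (Real.exp (dist h 1) - 1)) * (ε / 8) + (Real.exp (dist h 1) - 1) * C := by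
          have hg2 : g' x ≤ 1 + (Real.exp (dist h 1) - 1) :=
            sub_le_iff_le_add'.1 (abs_le.1 hg1).2
          exact add_le_add (mul_le_mul hg2 hψx.le (abs_nonneg _) (hg'0.le.trans hg2))
            (mul_le_mul hg1 (hC x) (abs_nonneg _) ((abs_nonneg _).trans hg1))
        _ ≤ ε / 4 := by linarith
    calc |g' x * φ (g x) - φ x|
        = |(g' x * (φ (g x) - ψ (g x)) + (g' x * ψ (g x) - ψ x)) + (ψ x - φ x)| := by ring_nf
      _ ≤ |g' x * (φ (g x) - ψ (g x))| + |g' x * ψ (g x) - ψ x| + |ψ x - φ x| := abs_add_three _ _ _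
      _ ≤ _ := by
        rw [abs_mul, abs_of_pos hg'0, abs_sub_comm (ψ x)]
        gcongr
  rw [intervalIntegral.integral_add (iB.add (by simp)) iA,
    intervalIntegral.integral_add iB (by simp),
    hh.integral_exp_logD_mul (fun x => |φ x - ψ x|)] at hle
  simp only [Real.norm_eq_abs] at hψ
  rw [intervalIntegral.integral_const, sub_zero, one_smul] at hle
  exact hle.trans_lt (by linarith)

theorem tendsto_const_mul_nhds_one (f : c1ac) : Tendsto (fun h => f * h) (𝓝 1) (𝓝 f) := by
  rw [tendsto_iff_dist_tendsto_zero]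
  have h1 := tendsto_derivNorm_comp_sub (isC1ac f).isAC_logD
  have h2 : Tendsto (fun h : c1ac => dist h 1) (𝓝 1) (𝓝 0) :=
    tendsto_iff_dist_tendsto_zero.1 tendsto_id
  refine squeeze_zero (fun _ => dist_nonneg) (fun h => ?_) (by simpa using h1.add h2)
  have hh := isC1ac h
  refine le_trans (le_of_eq (derivNorm_congr fun x hx => ?_)) ((IsAC.derivNorm_add_le
    ((hh.isAC_comp (isC1ac f).isAC_logD).fun_sub (isC1ac f).isAC_logD) hh.isAC_logD).trans_eq ?_)
  · rw [show ((f * h : c1ac) : HomeoPlus) = f * h from rfl, (isC1ac f).logD_mul hh hx]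
    ring
  · rw [dist_one]

theorem continuous_const_mul (f : c1ac) : Continuous (fun h => f * h) := by
  refine continuous_iff_continuousAt.2 fun g => tendsto_iff_dist_tendsto_zero.2 ?_
  have h1 : Tendsto (fun h : c1ac => h * g⁻¹) (𝓝 g) (𝓝 1) := by
    rw [tendsto_iff_dist_tendsto_zero]
    refine (tendsto_iff_dist_tendsto_zero.1 (tendsto_id (α := c1ac) (x := 𝓝 g))).congr fun h => ?_
    rw [id, dist_eq_dist_one]
  refine (tendsto_iff_dist_tendsto_zero.1 ((tendsto_const_mul_nhds_one f).comp h1)).congr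
    fun h => ?_
  rw [← dist_mul_right _ _ g]
  simp [mul_assoc]

/-- A group with a right-invariant metric is a topological group once left translations are
continuous. -/
instance : IsTopologicalGroup c1ac where
  continuous_mul := by
    refine continuous_iff_continuousAt.2 fun ⟨f, g⟩ => tendsto_iff_dist_tendsto_zero.2 ?_
    have h1 : Tendsto (fun p : c1ac × c1ac => dist p.1 f) (𝓝 (f, g)) (𝓝 0) :=
      tendsto_iff_dist_tendsto_zero.1 (continuous_fst.tendsto (f, g))
    have h2 : Tendsto (fun p : c1ac × c1ac => dist (f * p.2) (f * g)) (𝓝 (f, g)) (𝓝 0) :=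
      tendsto_iff_dist_tendsto_zero.1
        (((continuous_const_mul f).comp continuous_snd).tendsto (f, g))
    refine squeeze_zero (fun _ => dist_nonneg) (fun p => ?_) (by simpa using h1.add h2)
    have := dist_triangle (p.1 * p.2) (f * p.2) (f * g)
    rwa [dist_mul_right] at this
  continuous_inv := by
    refine continuous_iff_continuousAt.2 fun f => tendsto_iff_dist_tendsto_zero.2 ?_
    refine (tendsto_iff_dist_tendsto_zero.1 ((continuous_const_mul f⁻¹).tendsto f)).congr
      fun h => ?_
    rw [← dist_mul_right h⁻¹ f⁻¹ h, inv_mul_cancel, inv_mul_cancel, dist_comm]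

end c1ac
end HomeoPlus

/-! ### Diffeomorphisms with prescribed logarithmic derivative -/

namespace HomeoPlus

theorem exists_hasDerivWithinAt_exp {w : ℝ → ℝ} (hw : ContinuousOn w (Icc 0 1)) :
    ∃ f : HomeoPlus, ∀ x ∈ Icc (0 : ℝ) 1, HasDerivWithinAt f.toReal
      (Real.exp (w x - Real.log (∫ y in (0 : ℝ)..1, Real.exp (w y)))) (Icc 0 1) x := by
  set e : ℝ → ℝ := fun x => Real.exp (IccExtend (zero_le_one (α := ℝ)) ((Icc 0 1).domRestrict w) x)
    with he
  have hec : Continuous e :=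
    Real.continuous_exp.comp (continuousOn_iff_continuous_domRestrict.1 hw).Icc_extend'
  have hew : ∀ x ∈ Icc (0 : ℝ) 1, e x = Real.exp (w x) := fun x hx => by
    simp [he, IccExtend_of_mem _ _ hx]
  have hint : ∀ a b, IntervalIntegrable e volume a b := fun a b => hec.intervalIntegrable a b
  set Z := ∫ y in (0 : ℝ)..1, e y with hZ
  have hZpos : 0 < Z := intervalIntegral.intervalIntegral_pos_of_pos_on (hint 0 1)
    (fun x _ => Real.exp_pos _) zero_lt_one
  have hZw : ∫ y in (0 : ℝ)..1, Real.exp (w y) = Z :=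
    intervalIntegral.integral_congr fun x hx => by
      rw [uIcc_of_le zero_le_one] at hx
      exact (hew x hx).symm
  set F : ℝ → ℝ := fun x => (∫ y in (0 : ℝ)..x, e y) / Z with hF
  have hF' : ∀ x, HasDerivAt F (e x / Z) x := fun x =>
    (intervalIntegral.integral_hasDerivAt_right (hint 0 x)
      hec.stronglyMeasurable.stronglyMeasurableAtFilter hec.continuousAt).div_const Z
  have hmono : StrictMono F := strictMono_of_deriv_pos fun x => by
    rw [(hF' x).deriv]
    exact div_pos (Real.exp_pos _) hZpos
  have hF0 : F 0 = 0 := by simp [hF]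
  have hF1 : F 1 = 1 := by simp only [hF]; rw [← hZ, div_self hZpos.ne']
  have hFI : ∀ x : I, F x ∈ Icc (0 : ℝ) 1 := fun x =>
    ⟨hF0 ▸ hmono.monotone x.2.1, hF1 ▸ hmono.monotone x.2.2⟩
  let G : I → I := fun x => ⟨F x, hFI x⟩
  have hG : StrictMono G := fun x y hxy => hmono (Subtype.coe_lt_coe.2 hxy)
  have hGs : Function.Surjective G := fun y => by
    have hc : ContinuousOn F (Icc 0 1) := fun x _ => (hF' x).continuousAt.continuousWithinAt
    have := intermediate_value_Icc zero_le_one hc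
    rw [hF0, hF1] at this
    obtain ⟨x, hx, hxy⟩ := this y.2
    exact ⟨⟨x, hx⟩, Subtype.ext hxy⟩
  refine ⟨hG.orderIsoOfSurjective G hGs, fun x hx => ?_⟩
  rw [Real.exp_sub, hZw, Real.exp_log hZpos, ← hew x hx]
  exact (hF' x).hasDerivWithinAt.congr_of_mem
    (fun y hy => toReal_coe (hG.orderIsoOfSurjective G hGs) ⟨y, hy⟩) hx

namespace c1ac

/-- The diffeomorphism whose logarithmic derivative is `w`, up to the additive constant that
normalizes the total length to `1`. -/
noncomputable def ofLog (w : ℝ → ℝ) (hw : IsAC w) : c1ac :=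
  ⟨(exists_hasDerivWithinAt_exp hw.continuousOn).choose,
    isC1ac_of_hasDerivWithinAt (hw.fun_sub (AbsolutelyContinuousOnInterval.const _))
      (exists_hasDerivWithinAt_exp hw.continuousOn).choose_spec⟩

theorem logD_ofLog {w : ℝ → ℝ} (hw : IsAC w) {x : ℝ} (hx : x ∈ Icc (0 : ℝ) 1) :
    (ofLog w hw : HomeoPlus).logD x = w x - Real.log (∫ y in (0 : ℝ)..1, Real.exp (w y)) :=
  logD_eq_of_hasDerivWithinAt hx
    ((exists_hasDerivWithinAt_exp hw.continuousOn).choose_spec x hx)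

theorem dist_ofLog {w : ℝ → ℝ} (hw : IsAC w) (f : c1ac) :
    dist (ofLog w hw) f = derivNorm (fun x => w x - (f : HomeoPlus).logD x) := by
  rw [dist_eq, distStar_eq, ← derivNorm_add_const (fun x => w x - (f : HomeoPlus).logD x)
    (-Real.log (∫ y in (0 : ℝ)..1, Real.exp (w y)))]
  refine derivNorm_congr fun x hx => ?_
  simp only [logD_ofLog hw hx]
  ring

theorem dist_ofLog_ofLog {u v : ℝ → ℝ} (hu : IsAC u) (hv : IsAC v) :
    dist (ofLog u hu) (ofLog v hv) = derivNorm (fun x => u x - v x) := by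
  rw [dist_ofLog, ← derivNorm_add_const (fun x => u x - v x)
    (Real.log (∫ y in (0 : ℝ)..1, Real.exp (v y)))]
  refine derivNorm_congr fun x hx => ?_
  simp only [logD_ofLog hv hx]
  ring

theorem ofLog_eq {w : ℝ → ℝ} (hw : IsAC w) {f : c1ac}
    (h : EqOn w (f : HomeoPlus).logD (Icc 0 1)) : ofLog w hw = f := by
  rw [← dist_eq_zero, dist_ofLog, derivNorm_congr (v := fun _ => 0), derivNorm_const]
  exact fun x hx => sub_eq_zero.2 (h hx)

/-! ### Conjugation by averaged logarithmic derivatives -/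

theorem coe_mul (f g : c1ac) : ((f * g : c1ac) : HomeoPlus) = f * g := rfl

/-- The average of `log D(f^i)` over `0 ≤ i < N`. -/
noncomputable def avgLogD (f : c1ac) (N : ℕ) (x : ℝ) : ℝ :=
  (N : ℝ)⁻¹ * ∑ i ∈ Finset.range N, ((f ^ i : c1ac) : HomeoPlus).logD x

theorem isAC_avgLogD (f : c1ac) (N : ℕ) : IsAC (avgLogD f N) :=
  (AbsolutelyContinuousOnInterval.sum fun i _ => (isC1ac (f ^ i)).isAC_logD).const_mul _

/-- The path of diffeomorphisms from the identity with logarithmic derivative proportional to the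
average of `log D(f^i)`. -/
noncomputable def avgConj (f : c1ac) (N : ℕ) (t : ℝ) : c1ac :=
  ofLog (fun x => t * avgLogD f N x) ((isAC_avgLogD f N).const_mul t)

theorem avgConj_zero (f : c1ac) (N : ℕ) : avgConj f N 0 = 1 :=
  ofLog_eq _ fun x hx => by
    rw [show ((1 : c1ac) : HomeoPlus) = 1 from rfl, logD_one hx, zero_mul]

theorem continuous_avgConj (f : c1ac) (N : ℕ) : Continuous (avgConj f N) := by
  refine continuous_iff_continuousAt.2 fun s => tendsto_iff_dist_tendsto_zero.2 ?_
  have h : Continuous fun t : ℝ => |t - s| * derivNorm (avgLogD f N) := by fun_prop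
  refine (h.tendsto' s 0 (by simp)).congr fun t => ?_
  rw [avgConj, avgConj, dist_ofLog_ofLog, ← derivNorm_const_mul]
  simp only [sub_mul]

/-- The cocycle relation for `log D` turns the coboundary of the average along `g` into an
average of translates of `log Dg`, provided that `g` commutes with `f`. -/
theorem avgLogD_toReal_add {f g : c1ac} (hfg : Commute f g) {N : ℕ} (hN : N ≠ 0) {x : ℝ}
    (hx : x ∈ Icc (0 : ℝ) 1) :
    avgLogD f N ((g : HomeoPlus).toReal x) + (g : HomeoPlus).logD x = avgLogD f N x +
      (N : ℝ)⁻¹ * ∑ i ∈ Finset.range N,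
        (g : HomeoPlus).logD (((f ^ i : c1ac) : HomeoPlus).toReal x) := by
  have h : ∀ i, ((f ^ i : c1ac) : HomeoPlus).logD ((g : HomeoPlus).toReal x) +
      (g : HomeoPlus).logD x = ((f ^ i : c1ac) : HomeoPlus).logD x +
        (g : HomeoPlus).logD (((f ^ i : c1ac) : HomeoPlus).toReal x) := fun i => by
    rw [← (isC1ac (f ^ i)).logD_mul (isC1ac g) hx, ← coe_mul, (hfg.pow_left i).eq, coe_mul,
      (isC1ac g).logD_mul (isC1ac (f ^ i)) hx, add_comm]
  have h' := Finset.sum_congr (rfl : Finset.range N = Finset.range N) fun i _ => h i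
  rw [Finset.sum_add_distrib, Finset.sum_add_distrib, Finset.sum_const, Finset.card_range,
    nsmul_eq_mul] at h'
  have hN' : (N : ℝ) ≠ 0 := Nat.cast_ne_zero.2 hN
  rw [avgLogD, avgLogD, ← mul_add, ← h', mul_add, inv_mul_cancel_left₀ hN']

theorem dist_avgConj_conj {f g : c1ac} (hfg : Commute f g) {N : ℕ} (hN : N ≠ 0) (t : ℝ) :
    dist (avgConj f N t * g * (avgConj f N t)⁻¹) 1 =
      derivNorm (fun x => (1 - t) * (g : HomeoPlus).logD x + t * ((N : ℝ)⁻¹ *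
        ∑ i ∈ Finset.range N,
          (g : HomeoPlus).logD (((f ^ i : c1ac) : HomeoPlus).toReal x))) := by
  rw [← dist_eq_dist_one, dist_eq, distStar_eq]
  refine derivNorm_congr fun x hx => ?_
  have h := avgLogD_toReal_add hfg hN hx
  simp only [coe_mul, (isC1ac _).logD_mul (isC1ac g) hx]
  rw [avgConj, logD_ofLog _ hx, logD_ofLog _ (toReal_mem _ x)]
  linear_combination t * h

theorem isAC_logD_comp (f g : c1ac) :
    IsAC fun x => (g : HomeoPlus).logD ((f : HomeoPlus).toReal x) :=
  (isC1ac f).isAC_comp (isC1ac g).isAC_logD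

/-- Conjugating by the averages does not increase the variation of the elements commuting with
`f`. -/
theorem dist_avgConj_conj_le {f g : c1ac} (hfg : Commute f g) {N : ℕ} (hN : N ≠ 0) {t : ℝ}
    (ht : t ∈ Icc (0 : ℝ) 1) :
    dist (avgConj f N t * g * (avgConj f N t)⁻¹) 1 ≤ dist g 1 := by
  have hsum : IsAC fun x => ∑ i ∈ Finset.range N,
      (g : HomeoPlus).logD (((f ^ i : c1ac) : HomeoPlus).toReal x) :=
    AbsolutelyContinuousOnInterval.sum fun i _ => isAC_logD_comp (f ^ i) g
  have hle : derivNorm (fun x => ∑ i ∈ Finset.range N,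
      (g : HomeoPlus).logD (((f ^ i : c1ac) : HomeoPlus).toReal x)) ≤ N * dist g 1 := by
    refine (IsAC.derivNorm_sum_le fun i _ => isAC_logD_comp (f ^ i) g).trans_eq ?_
    rw [Finset.sum_congr rfl fun i _ => (isC1ac (f ^ i)).derivNorm_comp (isC1ac g).isAC_logD]
    simp [dist_one]
  have hN' : (0 : ℝ) < N := Nat.cast_pos.2 (Nat.pos_of_ne_zero hN)
  rw [dist_avgConj_conj hfg hN]
  refine (IsAC.derivNorm_add_le ((isC1ac g).isAC_logD.const_mul _)
    ((hsum.const_mul _).const_mul _)).trans ?_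
  rw [derivNorm_const_mul, derivNorm_const_mul _ t, derivNorm_const_mul _ (N : ℝ)⁻¹, ← dist_one,
    abs_of_nonneg (sub_nonneg.2 ht.2), abs_of_nonneg ht.1, abs_of_pos (inv_pos.2 hN')]
  have h2 : (N : ℝ)⁻¹ * derivNorm (fun x => ∑ i ∈ Finset.range N,
      (g : HomeoPlus).logD (((f ^ i : c1ac) : HomeoPlus).toReal x)) ≤ dist g 1 := by
    rwa [inv_mul_le_iff₀ hN']
  nlinarith [mul_le_mul_of_nonneg_left h2 ht.1]

theorem logD_pow (f : c1ac) (N : ℕ) {x : ℝ} (hx : x ∈ Icc (0 : ℝ) 1) :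
    ((f ^ N : c1ac) : HomeoPlus).logD x = ∑ i ∈ Finset.range N,
      (f : HomeoPlus).logD (((f ^ i : c1ac) : HomeoPlus).toReal x) := by
  induction N with
  | zero => simpa using logD_one hx
  | succ N ih =>
    rw [pow_succ', coe_mul, (isC1ac f).logD_mul (isC1ac _) hx, ih, Finset.sum_range_succ, add_comm]

/-- The fully averaged conjugate of `f` has the variation of `f ^ N` divided by `N`. -/
theorem dist_avgConj_conj_self (f : c1ac) {N : ℕ} (hN : N ≠ 0) :
    dist (avgConj f N 1 * f * (avgConj f N 1)⁻¹) 1 = (N : ℝ)⁻¹ * dist (f ^ N) 1 := by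
  rw [dist_avgConj_conj (Commute.refl f) hN, dist_one,
    ← abs_of_nonneg (inv_nonneg.2 N.cast_nonneg : (0 : ℝ) ≤ (N : ℝ)⁻¹), ← derivNorm_const_mul,
    abs_of_nonneg (inv_nonneg.2 N.cast_nonneg : (0 : ℝ) ≤ (N : ℝ)⁻¹)]
  refine derivNorm_congr fun x hx => ?_
  simp only [logD_pow f N hx]
  ring

/-! ### Convex interpolation with the identity -/

/-- `log Df_t` as a function of `log Df`, for the interpolation `f_t = (1 - t) f + t id`. -/
noncomputable def logInterp (t y : ℝ) : ℝ := Real.log ((1 - t) * Real.exp y + t)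

theorem interp_pos {t : ℝ} (ht : t ∈ Icc (0 : ℝ) 1) (y : ℝ) : 0 < (1 - t) * Real.exp y + t := by
  rcases ht.1.eq_or_lt with rfl | h
  · simpa using Real.exp_pos y
  · have := mul_nonneg (sub_nonneg.2 ht.2) (Real.exp_pos y).le
    linarith

theorem contDiff_logInterp {t : ℝ} (ht : t ∈ Icc (0 : ℝ) 1) : ContDiff ℝ 1 (logInterp t) :=
  ((contDiff_const.mul Real.contDiff_exp).add contDiff_const).log fun y => (interp_pos ht y).ne'

theorem hasDerivAt_logInterp {t : ℝ} (ht : t ∈ Icc (0 : ℝ) 1) (y : ℝ) :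
    HasDerivAt (logInterp t) ((1 - t) * Real.exp y / ((1 - t) * Real.exp y + t)) y :=
  (((Real.hasDerivAt_exp y).const_mul (1 - t)).add_const t).log (interp_pos ht y).ne'

theorem abs_deriv_logInterp_le {t : ℝ} (ht : t ∈ Icc (0 : ℝ) 1) (y : ℝ) :
    |deriv (logInterp t) y| ≤ 1 := by
  have h := mul_nonneg (sub_nonneg.2 ht.2) (Real.exp_pos y).le
  rw [(hasDerivAt_logInterp ht y).deriv, abs_of_nonneg (div_nonneg h (interp_pos ht y).le),
    div_le_one (interp_pos ht y)]
  linarith [ht.1]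

theorem abs_deriv_logInterp_sub_le {s t y K : ℝ} (hs : s ∈ Icc (0 : ℝ) 1)
    (ht : t ∈ Icc (0 : ℝ) 1) (hK : 0 ≤ K) (hy : |y| ≤ K) :
    |deriv (fun z => logInterp t z - logInterp s z) y| ≤ Real.exp (3 * K) * |t - s| := by
  have hlow : ∀ r ∈ Icc (0 : ℝ) 1, Real.exp (-K) ≤ (1 - r) * Real.exp y + r := by
    intro r hr
    have h1 : Real.exp (-K) ≤ Real.exp y := Real.exp_le_exp.2 (abs_le.1 hy).1
    have h2 : Real.exp (-K) ≤ 1 := Real.exp_le_one_iff.2 (by linarith)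
    nlinarith [mul_le_mul_of_nonneg_left h1 (sub_nonneg.2 hr.2),
      mul_le_mul_of_nonneg_left h2 hr.1]
  have hup : Real.exp y ≤ Real.exp K := Real.exp_le_exp.2 (abs_le.1 hy).2
  have hpt := interp_pos ht y
  have hps := interp_pos hs y
  rw [((hasDerivAt_logInterp ht y).fun_sub (hasDerivAt_logInterp hs y)).deriv,
    div_sub_div _ _ hpt.ne' hps.ne', abs_div, abs_of_pos (mul_pos hpt hps),
    div_le_iff₀ (mul_pos hpt hps),
    show (1 - t) * Real.exp y * ((1 - s) * Real.exp y + s) -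
      ((1 - t) * Real.exp y + t) * ((1 - s) * Real.exp y) = Real.exp y * -(t - s) by ring,
    abs_mul, abs_neg, abs_of_pos (Real.exp_pos y)]
  have hprod : Real.exp (-K) * Real.exp (-K) ≤
      ((1 - t) * Real.exp y + t) * ((1 - s) * Real.exp y + s) :=
    mul_le_mul (hlow t ht) (hlow s hs) (Real.exp_pos _).le hpt.le
  calc Real.exp y * |t - s| ≤ Real.exp K * |t - s| := by gcongr
    _ = Real.exp (3 * K) * |t - s| * (Real.exp (-K) * Real.exp (-K)) := by
      rw [← Real.exp_add, mul_right_comm, ← Real.exp_add]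
      ring_nf
    _ ≤ _ := by gcongr

theorem isAC_logInterp_logD (f : c1ac) {t : ℝ} (ht : t ∈ Icc (0 : ℝ) 1) :
    IsAC fun x => logInterp t ((f : HomeoPlus).logD x) :=
  AbsolutelyContinuousOnInterval.contDiff_comp (isC1ac f).isAC_logD (contDiff_logInterp ht)

/-- The convex interpolation `(1 - t) f + t id`, given by its logarithmic derivative. -/
noncomputable def interp (f : c1ac) (t : I) : c1ac :=
  ofLog (fun x => logInterp t ((f : HomeoPlus).logD x)) (isAC_logInterp_logD f t.2)

theorem logD_interp (f : c1ac) (t : I) {x : ℝ} (hx : x ∈ Icc (0 : ℝ) 1) :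
    (interp f t : HomeoPlus).logD x = logInterp t ((f : HomeoPlus).logD x) := by
  have hint : IntervalIntegrable (fun y => Real.exp ((f : HomeoPlus).logD y)) volume 0 1 :=
    ContinuousOn.intervalIntegrable (by
      rw [uIcc_of_le zero_le_one]
      exact Real.continuous_exp.comp_continuousOn (isC1ac f).isAC_logD.continuousOn)
  -- the normalizing constant is trivial, since `∫ ((1 - t) Df + t) = 1`
  have h1 : ∫ y in (0 : ℝ)..1, Real.exp ((f : HomeoPlus).logD y) = 1 := by
    simpa using (isC1ac f).integral_exp_logD_mul fun _ => 1
  have h2 : ∫ y in (0 : ℝ)..1, Real.exp (logInterp t ((f : HomeoPlus).logD y)) = 1 := by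
    simp only [logInterp, Real.exp_log (interp_pos t.2 _)]
    rw [intervalIntegral.integral_add (hint.const_mul _) (by simp),
      intervalIntegral.integral_const_mul, h1]
    simp
  rw [interp, logD_ofLog _ hx, h2, Real.log_one, sub_zero]

theorem interp_zero (f : c1ac) : interp f 0 = f :=
  ofLog_eq _ fun x _ => by simp [logInterp]

theorem interp_one (f : c1ac) : interp f 1 = 1 :=
  ofLog_eq _ fun x hx => by
    rw [show ((1 : c1ac) : HomeoPlus) = 1 from rfl, logD_one hx]
    simp [logInterp]

theorem dist_interp_le (f : c1ac) (t : I) : dist (interp f t) 1 ≤ dist f 1 := by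
  rw [dist_one, dist_one, derivNorm_congr fun x hx => logD_interp f t hx]
  simpa using (isC1ac f).isAC_logD.derivNorm_comp_le (contDiff_logInterp t.2)
    fun x _ => abs_deriv_logInterp_le t.2 _

theorem continuous_interp (f : c1ac) : Continuous (interp f) := by
  refine continuous_iff_continuousAt.2 fun s => tendsto_iff_dist_tendsto_zero.2 ?_
  obtain ⟨K, hK⟩ := (isC1ac f).isAC_logD.exists_bound
  have hK0 : 0 ≤ K := (abs_nonneg _).trans (hK 0 (by simp))
  have h : Continuous fun t : I => Real.exp (3 * K) * |(t : ℝ) - s| * dist f 1 := by fun_prop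
  refine squeeze_zero (fun _ => dist_nonneg) (fun t => ?_) (h.tendsto' s 0 (by simp))
  rw [interp, interp, dist_ofLog_ofLog, dist_one]
  exact (isC1ac f).isAC_logD.derivNorm_comp_le
    ((contDiff_logInterp t.2).sub (contDiff_logInterp s.2))
    fun x hx => abs_deriv_logInterp_sub_le s.2 t.2 hK0 (hK x hx)

end c1ac
end HomeoPlus

/-! ### Derivatives at the endpoints -/

namespace HomeoPlus

theorem toReal_endpoint {p : I} (hp : p = 0 ∨ p = 1) (f : HomeoPlus) : f.toReal p = p := by
  rcases hp with rfl | rfl <;> simp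

namespace c1ac

/-- Evaluating `log D` at an endpoint, which all diffeomorphisms fix, is a homomorphism. -/
noncomputable def endpointLogD (p : I) (hp : p = 0 ∨ p = 1) : c1ac →* Multiplicative ℝ where
  toFun f := Multiplicative.ofAdd ((f : HomeoPlus).logD p)
  map_one' := congrArg Multiplicative.ofAdd (logD_one p.2)
  map_mul' f g := by
    rw [coe_mul, (isC1ac f).logD_mul (isC1ac g) p.2, toReal_endpoint hp, ofAdd_add]

theorem isParabolicAt_iff {p : I} (hp : p = 0 ∨ p = 1) (f : c1ac) :
    (f : HomeoPlus).IsParabolicAt p ↔ endpointLogD p hp f = 1 := by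
  have h1 : (f : HomeoPlus) p = p :=
    Subtype.ext (by rw [← toReal_coe, toReal_endpoint hp])
  have h2 : endpointLogD p hp f = 1 ↔ (f : HomeoPlus).logD p = 0 := ofAdd_eq_one
  rw [IsParabolicAt, h2, and_iff_right h1, logD]
  refine ⟨fun h => by rw [h, Real.log_one], Real.eq_one_of_pos_of_log_eq_zero ?_⟩
  exact (isC1ac f).D_pos p p.2

theorem endpointLogD_interp {p : I} (hp : p = 0 ∨ p = 1) {f : c1ac}
    (hf : endpointLogD p hp f = 1) (t : I) : endpointLogD p hp (interp f t) = 1 := by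
  have h : (f : HomeoPlus).logD p = 0 := ofAdd_eq_one.1 hf
  refine ofAdd_eq_one.2 ?_
  rw [logD_interp f t p.2, h]
  simp [logInterp]

/-! ### The path of diffeomorphisms -/

/-- A diffeomorphism `f` is joined to the identity through diffeomorphisms `γ t` whose powers, up
to the exponent `N`, have variation at most that of the corresponding power of `f` or of `f ^ N`,
without losing parabolicity at the endpoints. -/
theorem exists_path (f : c1ac) {N : ℕ} (hN : N ≠ 0) :
    ∃ γ : Path f 1,
      (∀ t, ∀ n : ℤ, n.natAbs ≤ N → dist (γ t ^ n) 1 ≤ max (dist (f ^ n) 1) (dist (f ^ N) 1)) ∧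
      ∀ (p : I) (hp : p = 0 ∨ p = 1), endpointLogD p hp f = 1 →
        ∀ t, endpointLogD p hp (γ t) = 1 := by
  set g : c1ac := avgConj f N 1 * f * (avgConj f N 1)⁻¹ with hg
  have hc : Continuous fun t : I => avgConj f N t :=
    (continuous_avgConj f N).comp continuous_subtype_val
  let α : Path f g :=
    { toFun := fun t => avgConj f N t * f * (avgConj f N t)⁻¹
      continuous_toFun := (hc.mul continuous_const).mul hc.inv
      source' := by simp [avgConj_zero]
      target' := by simp [hg] }
  let β : Path g 1 := ⟨⟨interp g, continuous_interp g⟩, interp_zero g, interp_one g⟩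
  have hmem : ∀ t, (∃ s, α s = α.trans β t) ∨ ∃ s, β s = α.trans β t := fun t => by
    have : α.trans β t ∈ range α ∪ range β := Path.trans_range α β ▸ mem_range_self t
    exact this
  have hpar : ∀ (p : I) (hp : p = 0 ∨ p = 1) (h : c1ac),
      endpointLogD p hp (h * f * h⁻¹) = endpointLogD p hp f := fun p hp h => by
    rw [map_mul, map_mul, map_inv, mul_inv_cancel_comm]
  refine ⟨α.trans β, fun t n hn => ?_, fun p hp hf t => ?_⟩
  · rcases hmem t with ⟨s, hs⟩ | ⟨s, hs⟩
    · rw [← hs, show α s = avgConj f N s * f * (avgConj f N s)⁻¹ from rfl, conj_zpow]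
      exact (dist_avgConj_conj_le ((Commute.refl f).zpow_right n) hN s.2).trans (le_max_left _ _)
    · have hN' : (0 : ℝ) < N := Nat.cast_pos.2 (Nat.pos_of_ne_zero hN)
      rw [← hs, show β s = interp g s from rfl, dist_zpow_one_eq]
      refine le_trans ?_ (le_max_right _ _)
      calc dist (interp g s ^ n.natAbs) 1 ≤ n.natAbs * dist (interp g s) 1 := dist_pow_one_le _ _
        _ ≤ N * dist g 1 := by
          gcongr
          exact dist_interp_le g s
        _ = dist (f ^ N) 1 := by
          rw [hg, dist_avgConj_conj_self f hN, mul_inv_cancel_left₀ hN'.ne']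
  · rcases hmem t with ⟨s, hs⟩ | ⟨s, hs⟩
    · rw [← hs, show α s = avgConj f N s * f * (avgConj f N s)⁻¹ from rfl, hpar, hf]
    · rw [← hs]
      exact endpointLogD_interp hp (by rw [hg, hpar, hf]) s

end c1ac

theorem dist1ac_nonneg (f g : HomeoPlus) : 0 ≤ f.dist1ac g :=
  add_nonneg (Real.iSup_nonneg fun _ => abs_nonneg _) (distStar_nonneg f g)

end HomeoPlus

/-! ### Actions through powers of one diffeomorphism -/

namespace ZAction

open HomeoPlus

variable {d : ℕ}

theorem closure_range_gen :
    Subgroup.closure (range (gen : Fin d → Multiplicative (Fin d → ℤ))) = ⊤ := by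
  refine eq_top_iff.2 fun v _ => ?_
  have h : v = ∏ i, gen i ^ (v.toAdd i) := by
    refine Multiplicative.toAdd.injective ?_
    rw [toAdd_prod]
    simp only [toAdd_zpow, gen, toAdd_ofAdd]
    refine (pi_eq_sum_univ' v.toAdd).trans (Finset.sum_congr rfl fun i _ => ?_)
    congr 1
  rw [h]
  exact Subgroup.prod_mem _ fun i _ =>
    Subgroup.zpow_mem _ (Subgroup.subset_closure (mem_range_self i)) _

theorem ext_gen {ρ η : ZAction d} (h : ∀ i, ρ (gen i) = η (gen i)) : ρ = η :=
  MonoidHom.eq_of_eqOn_dense closure_range_gen (by rintro _ ⟨i, rfl⟩; exact h i)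

/-- The action by powers of `f` in which the `i`-th generator acts as `f ^ n i`. -/
def ofPowers (n : Fin d → ℤ) (f : c1ac) : ZAction d :=
  c1ac.subtype.comp ((zpowersHom c1ac f).comp
    (∑ i, n i • Pi.evalAddMonoidHom (fun _ : Fin d => ℤ) i).toMultiplicative)

theorem ofPowers_apply (n : Fin d → ℤ) (f : c1ac) (v : Multiplicative (Fin d → ℤ)) :
    ∃ k : ℤ, ofPowers n f v = (f ^ k : c1ac) :=
  ⟨_, rfl⟩

theorem ofPowers_gen (n : Fin d → ℤ) (f : c1ac) (i : Fin d) :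
    ofPowers n f (gen i) = (f ^ n i : c1ac) := by
  have h : (∑ j, n j • Pi.evalAddMonoidHom (fun _ : Fin d => ℤ) j) (Pi.single i 1) = n i := by
    simp [Pi.single_apply]
  exact congrArg (fun k : ℤ => ((f ^ k : c1ac) : HomeoPlus)) h

theorem ofPowers_one (n : Fin d → ℤ) : ofPowers n 1 = 1 :=
  ext_gen fun i => by simp [ofPowers_gen]

theorem distStar_ofPowers_one (n : Fin d → ℤ) (f : c1ac) :
    (ofPowers n f).distStar 1 = ⨆ i, dist (f ^ n i) 1 := by
  simp only [ZAction.distStar, ofPowers_gen]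
  rfl

theorem isC1acPath_ofPowers (n : Fin d → ℤ) {γ : I → c1ac} (hγ : Continuous γ) :
    IsC1acPath fun t => ofPowers n (γ t) where
  isC1ac t v := by
    obtain ⟨k, hk⟩ := ofPowers_apply n (γ t) v
    rw [hk]
    exact c1ac.isC1ac _
  continuous s := by
    have h : ∀ i, Tendsto (fun t => (Real.exp (dist (γ t ^ n i) (γ s ^ n i)) - 1) +
        dist (γ t ^ n i) (γ s ^ n i)) (𝓝 s) (𝓝 0) := fun i => by
      have hc : Continuous fun t => (Real.exp (dist (γ t ^ n i) (γ s ^ n i)) - 1) +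
          dist (γ t ^ n i) (γ s ^ n i) := by fun_prop
      exact hc.tendsto' s 0 (by simp)
    refine squeeze_zero (fun t => Real.iSup_nonneg fun i => dist1ac_nonneg _ _) (fun t => ?_)
      (by simpa using tendsto_finsetSum Finset.univ fun i _ => h i)
    have hnn : ∀ i, 0 ≤ (Real.exp (dist (γ t ^ n i) (γ s ^ n i)) - 1) +
        dist (γ t ^ n i) (γ s ^ n i) := fun i =>
      add_nonneg (sub_nonneg.2 (Real.one_le_exp dist_nonneg)) dist_nonneg
    refine Real.iSup_le (fun i => ?_) (Finset.sum_nonneg fun i _ => hnn i)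
    rw [ofPowers_gen, ofPowers_gen]
    exact ((c1ac.isC1ac _).dist1ac_le (c1ac.isC1ac _)).trans
      (Finset.single_le_sum (f := fun i => (Real.exp (dist (γ t ^ n i) (γ s ^ n i)) - 1) +
        dist (γ t ^ n i) (γ s ^ n i)) (fun i _ => hnn i) (Finset.mem_univ i))

/-- An action by `C^{1+ac}` diffeomorphisms with cyclic image acts by powers of one of its
elements. -/
theorem exists_eq_ofPowers {ρ : ZAction d} (hρ : ρ.IsC1ac) (hcyc : IsCyclic ρ.range) :
    ∃ (v : Multiplicative (Fin d → ℤ)) (n : Fin d → ℤ), ρ = ofPowers n ⟨ρ v, hρ v⟩ := by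
  obtain ⟨⟨_, v, rfl⟩, hgen⟩ := hcyc
  have h : ∀ i, ∃ k : ℤ, ρ v ^ k = ρ (gen i) := fun i => by
    obtain ⟨k, hk⟩ := hgen ⟨ρ (gen i), gen i, rfl⟩
    exact ⟨k, congrArg Subtype.val hk⟩
  choose n hn using h
  exact ⟨v, n, ext_gen fun i => by rw [ofPowers_gen, ← hn i]; rfl⟩

end ZAction

theorem mainTheorem8 (d : ℕ) (ρ₀ : ZAction d) (hρ₀ : ρ₀.IsC1ac)
    (hcyc : IsCyclic ρ₀.range) :
    ∃ γ : I → ZAction d,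
      ZAction.IsC1acPath γ ∧ γ 0 = ρ₀ ∧ γ 1 = 1 ∧
      (∀ t, (γ t).distStar 1 ≤ 2 * ρ₀.distStar 1) ∧
      (∀ p : I, p = 0 ∨ p = 1 →
        (∀ v, (ρ₀ v).IsParabolicAt p) → ∀ t v, (γ t v).IsParabolicAt p) := by
  obtain ⟨v₀, n, hρ⟩ := ZAction.exists_eq_ofPowers hρ₀ hcyc
  set f : HomeoPlus.c1ac := ⟨ρ₀ v₀, hρ₀ v₀⟩
  -- `N` is the largest exponent; it is replaced by `1` for the trivial action
  obtain ⟨N, hN, hnN, hbound⟩ : ∃ N : ℕ, N ≠ 0 ∧ (∀ i, (n i).natAbs ≤ N) ∧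
      ((∀ i, n i = 0) ∨ ∃ i, (n i).natAbs = N) := by
    by_cases h : ∀ i, n i = 0
    · exact ⟨1, one_ne_zero, fun i => by simp [h i], Or.inl h⟩
    · obtain ⟨j, hj⟩ := not_forall.1 h
      have : Nonempty (Fin d) := ⟨j⟩
      obtain ⟨i, hi⟩ := Finite.exists_max fun i => (n i).natAbs
      exact ⟨_, ((Int.natAbs_pos.2 hj).trans_le (hi j)).ne', hi, Or.inr ⟨i, rfl⟩⟩
  obtain ⟨γ, hγ, hpar⟩ := HomeoPlus.c1ac.exists_path f hN
  refine ⟨fun t => ZAction.ofPowers n (γ t), ZAction.isC1acPath_ofPowers n γ.continuous, ?_, ?_,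
    fun t => ?_, fun p hp h t v => ?_⟩
  · exact (congrArg (ZAction.ofPowers n) γ.source).trans hρ.symm
  · exact (congrArg (ZAction.ofPowers n) γ.target).trans (ZAction.ofPowers_one n)
  · have hρ' : ρ₀.distStar 1 = ⨆ i, dist (f ^ n i) 1 := by
      conv_lhs => rw [hρ]
      exact ZAction.distStar_ofPowers_one n f
    have h0 : 0 ≤ ρ₀.distStar 1 := hρ' ▸ Real.iSup_nonneg fun _ => dist_nonneg
    have hle : ∀ i, dist (f ^ n i) 1 ≤ ρ₀.distStar 1 := fun i =>
      hρ' ▸ le_ciSup (f := fun i => dist (f ^ n i) 1) (Set.finite_range _).bddAbove i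
    rw [ZAction.distStar_ofPowers_one]
    refine (Real.iSup_le (fun i => ?_) h0).trans (by linarith)
    rcases hbound with h | ⟨j, hj⟩
    · simpa [h i] using h0
    · refine (hγ t (n i) (hnN i)).trans (max_le (hle i) ?_)
      rw [← hj, ← HomeoPlus.c1ac.dist_zpow_one_eq]
      exact hle j
  · obtain ⟨k, hk⟩ := ZAction.ofPowers_apply n (γ t) v
    have hfp := (HomeoPlus.c1ac.isParabolicAt_iff hp f).1 (h v₀)
    rw [hk, HomeoPlus.c1ac.isParabolicAt_iff hp, map_zpow, hpar p hp hfp t, one_zpow]
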